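/- Let $\Sigma$ be a signature consisting of finitely many relation symbols and constant symbols. For a finite $\Sigma$-structure $\mathcal A$ with domain $A$, let $\mathrm{adom}(\mathcal A)$ be the set of all elements of $A$ that occur in some tuple of a relation of $\mathcal A$ or interpret a constant symbol. For $D\subseteq A$ with $\mathrm{adom}(\mathcal A)\subseteq D$, let $\mathcal A|_D$ be the structure induced by $\mathcal A$ on $D$. A $k$-ary query $q$ maps each finite $\Sigma$-structure $\mathcal A$ to a relation $q(\mathcal A)\subseteq A^k$. It is MSO-definable if there is a formula $\varphi(x_1,\dots,x_k)$ of monadic second-order logic over $\Sigma$, without free set variables, such that $q(\mathcal A)=\{\bar a\in A^k : \mathcal A\models\varphi(\bar a)\}$ for all finite $\mathcal A$. For $c\in\mathbb N$, we say that $q$ is almost domain independent with constant $c$ if for every finite $\Sigma$-structure $\mathcal A$ and every set $B\subseteq A\setminus \mathrm{adom}(\mathcal A)$ with $|B|\ge c$, $$q(\mathcal A)\cap D^k = q(\mathcal A|_D),\qquad\text{where } D=\mathrm{adom}(\mathcal A)\cup B;$$ and $q$ is almost domain independent if this holds for some $c\in\mathbb N$. **Proposition.** Every MSO-definable query is almost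 domain independent. More precisely, if $q$ is defined by an MSO formula $\varphi$ of quantifier depth $d$ (the maximum nesting depth of element and set quantifiers) with $e$ free element variables (so that $q$ is $e$-ary), then $q$ is almost domain independent with constant $c=2^d d+e$. -/

import Mathlib

universe u v w

namespace MSOQuery

open FirstOrder

/-- A signature whose only function symbols are constants: relation symbols of arbitrary arity and
constant symbols, finitely many in total. -/
class IsSignature (L : FirstOrder.Language.{u, v}) : Prop where
  finite_symbols : Finite L.Symbols
  isEmpty_functions : ∀ n : ℕ, IsEmpty (L.Functions (n + 1))

/-- The active domain of a structure: all elements that occur in some tuple of a relation or that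
interpret some constant symbol. -/
def adom (L : FirstOrder.Language.{u, v}) (A : Type w) [L.Structure A] : Set A :=
  {a | (∃ (n : ℕ) (R : L.Relations n) (x : Fin n → A),
          Language.Structure.RelMap R x ∧ ∃ i, x i = a) ∨
       ∃ c : L.Constants, (c : A) = a}

/-- The induced structure on `adom A ∪ B`. As a Mathlib substructure it carries the
restrictions of all relations and the same constants. -/
def restrict (L : FirstOrder.Language.{u, v}) [hL : IsSignature L] (A : Type w) [L.Structure A] (B : Set A) :
    L.Substructure A where
  carrier := adom L A ∪ B
  fun_mem := by
    intro n f x _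
    cases n with
    | zero =>
      refine Or.inl (Or.inr ⟨f, ?_⟩)
      exact Language.funMap_eq_coe_constants.symm
    | succ n => exact (hL.isEmpty_functions n).elim f

/-- Monadic second-order formulas over `L` with free element variables `x₀, …, xₙ₋₁` and free set
variables `X₀, …, Xₘ₋₁`. A quantifier over elements binds `xₙ`, a quantifier over sets binds `Xₘ`.
The other connectives are expressed by implication and falsity, without change of the depth. -/
inductive MSOFormula (L : FirstOrder.Language.{u, v}) : ℕ → ℕ → Type (max u v)
  | falsum {n m : ℕ} : MSOFormula L n m
  | equal {n m : ℕ} (s t : L.Term (Fin n)) : MSOFormula L n m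
  | rel {n m l : ℕ} (R : L.Relations l) (t : Fin l → L.Term (Fin n)) : MSOFormula L n m
  | mem {n m : ℕ} (t : L.Term (Fin n)) (X : Fin m) : MSOFormula L n m
  | imp {n m : ℕ} (φ ψ : MSOFormula L n m) : MSOFormula L n m
  | allElem {n m : ℕ} (φ : MSOFormula L (n + 1) m) : MSOFormula L n m
  | exElem {n m : ℕ} (φ : MSOFormula L (n + 1) m) : MSOFormula L n m
  | allSet {n m : ℕ} (φ : MSOFormula L n (m + 1)) : MSOFormula L n m
  | exSet {n m : ℕ} (φ : MSOFormula L n (m + 1)) : MSOFormula L n m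

namespace MSOFormula

variable {L : FirstOrder.Language.{u, v}}

/-- Maximum nesting depth of quantifiers, over elements and over sets alike. -/
def depth : {n m : ℕ} → MSOFormula L n m → ℕ
  | _, _, falsum => 0
  | _, _, equal _ _ => 0
  | _, _, rel _ _ => 0
  | _, _, mem _ _ => 0
  | _, _, imp φ ψ => max φ.depth ψ.depth
  | _, _, allElem φ => φ.depth + 1
  | _, _, exElem φ => φ.depth + 1
  | _, _, allSet φ => φ.depth + 1
  | _, _, exSet φ => φ.depth + 1

/-- Satisfaction in `A` under the assignment `x` of elements and `X` of sets. -/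
def Realize {A : Type w} [L.Structure A] :
    {n m : ℕ} → MSOFormula L n m → (Fin n → A) → (Fin m → Set A) → Prop
  | _, _, falsum, _, _ => False
  | _, _, equal s t, x, _ => s.realize x = t.realize x
  | _, _, rel R t, x, _ => Language.Structure.RelMap R fun i => (t i).realize x
  | _, _, mem t i, x, X => t.realize x ∈ X i
  | _, _, imp φ ψ, x, X => φ.Realize x X → ψ.Realize x X
  | _, _, allElem φ, x, X => ∀ a : A, φ.Realize (Fin.snoc (α := fun _ => A) x a) X
  | _, _, exElem φ, x, X => ∃ a : A, φ.Realize (Fin.snoc (α := fun _ => A) x a) X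
  | _, _, allSet φ, x, X => ∀ S : Set A, φ.Realize x (Fin.snoc (α := fun _ => Set A) X S)
  | _, _, exSet φ, x, X => ∃ S : Set A, φ.Realize x (Fin.snoc (α := fun _ => Set A) X S)

end MSOFormula

/-- A `k`-ary query: it assigns a `k`-ary relation on the domain to every finite structure.
(Invariance under isomorphism is not required; definable queries have it.) -/
def Query (L : FirstOrder.Language.{u, v}) (k : ℕ) : Type (max u v (w + 1)) :=
  ∀ (A : Type w) [Finite A] [L.Structure A], Set (Fin k → A)

namespace Query

variable {L : FirstOrder.Language.{u, v}} {k : ℕ}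

/-- `q` is defined by `φ(x₀, …, xₖ₋₁)`, a formula without free set variables. -/
def DefinedBy (q : Query.{u, v, w} L k) (φ : MSOFormula L k 0) : Prop :=
  ∀ (A : Type w) [Finite A] [L.Structure A], q A = {a | φ.Realize a Fin.elim0}

/-- `q` is definable in monadic second-order logic. -/
def IsMSODefinable (q : Query.{u, v, w} L k) : Prop :=
  ∃ φ : MSOFormula L k 0, q.DefinedBy φ

/-- For every finite structure `A` and every set `B` of at least `c` elements outside the active
domain, the restriction of `q(A)` to `adom A ∪ B` is the result of `q` on the structure induced by
`adom A ∪ B`. -/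
def AlmostDomainIndependentWith [IsSignature L] (q : Query.{u, v, w} L k) (c : ℕ) : Prop :=
  ∀ (A : Type w) [Finite A] [L.Structure A] (B : Set A),
    B ⊆ (adom L A)ᶜ → c ≤ B.ncard →
      {a : Fin k → restrict L A B | (fun i => (a i : A)) ∈ q A} = q (restrict L A B)

/-- `q` is almost domain independent. -/
def AlmostDomainIndependent [IsSignature L] (q : Query.{u, v, w} L k) : Prop :=
  ∃ c : ℕ, q.AlmostDomainIndependentWith c

end Query

end MSOQuery

namespace MSOQuery

open FirstOrder

/-! The proof is an Ehrenfeucht–Fraïssé game for MSO between the structure and its restriction.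
Elements outside the active domain differ only by equality and by membership in the chosen sets, so
beyond a partial isomorphism only the cell sizes matter, up to `2 ^ r - 1` with `r` rounds left. An
element move removes at most one point from one cell (`Similar.exists_elem`); a set move splits
every cell in two (`Similar.exists_set`). Both are affordable because `2 ^ (r + 1) - 1 = 2 * (2 ^ r
- 1) + 1`. A large `B` makes the initial position similar (`similar_restrict`). -/

/-! ### Counting up to a threshold -/

/-- Two cardinalities agree, or are both at least `t`. -/
def AgreeUpTo (t a b : ℕ) : Prop := a = b ∨ (t ≤ a ∧ t ≤ b)

lemma AgreeUpTo.symm {t a b : ℕ} (h : AgreeUpTo t a b) : AgreeUpTo t b a := by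
  unfold AgreeUpTo at *; omega

/-- If both totals are at least `2 * t`, a part smaller than `t` is copied exactly and the other
part takes the rest, which is still at least `t`. -/
lemma AgreeUpTo.exists_split {t a₁ a₂ b : ℕ} (h : AgreeUpTo (2 * t) (a₁ + a₂) b) :
    ∃ b₁ b₂, b₁ + b₂ = b ∧ AgreeUpTo t a₁ b₁ ∧ AgreeUpTo t a₂ b₂ := by
  unfold AgreeUpTo at *
  rcases h with h | h
  · exact ⟨a₁, a₂, h, .inl rfl, .inl rfl⟩
  by_cases h₁ : a₁ < t
  · exact ⟨a₁, b - a₁, by omega, by omega, by omega⟩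
  by_cases h₂ : a₂ < t
  · exact ⟨b - a₂, a₂, by omega, by omega, by omega⟩
  exact ⟨t, b - t, by omega, by omega, by omega⟩

lemma AgreeUpTo.exists_subset {α β : Type*} [Finite α] [Finite β] {t : ℕ} {U S : Set α}
    {V : Set β} (h : AgreeUpTo (2 * t) U.ncard V.ncard) :
    ∃ T ⊆ V, AgreeUpTo t (U ∩ S).ncard T.ncard ∧ AgreeUpTo t (U \ S).ncard (V \ T).ncard := by
  rw [← Set.ncard_inter_add_ncard_sdiff_eq_ncard U S (Set.toFinite _)] at h
  obtain ⟨b₁, b₂, hb, h₁, h₂⟩ := h.exists_split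
  obtain ⟨T, hT, rfl⟩ := Set.exists_subset_card_eq (s := V) (n := b₁) (by omega)
  refine ⟨T, hT, h₁, ?_⟩
  rw [Set.ncard_sdiff hT (Set.toFinite _), ← hb, Nat.add_sub_cancel_left]
  exact h₂

/-! ### Positions of the game -/

/-- The elements on the left that are related to nothing and lie in `X j` exactly if `s j`. -/
def cell {A B : Type*} {m : ℕ} (ρ : A → B → Prop) (X : Fin m → Set A) (s : Fin m → Prop) : Set A :=
  {a | (∀ b, ¬ ρ a b) ∧ ∀ j, a ∈ X j ↔ s j}

lemma cell_snoc {A B : Type*} {m : ℕ} (ρ : A → B → Prop) (X : Fin m → Set A) (S : Set A)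
    (s : Fin (m + 1) → Prop) :
    cell ρ (Fin.snoc (α := fun _ => Set A) X S) s =
      {a | a ∈ cell ρ X (fun j => s j.castSucc) ∧ (a ∈ S ↔ s (Fin.last m))} := by
  ext a
  simp [cell, Fin.forall_fin_succ', and_assoc]

section Similar

variable {L : FirstOrder.Language.{u, v}} {A B : Type*} [L.Structure A] [L.Structure B]

/-- `ρ` is a partial isomorphism defined on the active domains. -/
structure IsPartialIso (L : FirstOrder.Language.{u, v}) {A B : Type*} [L.Structure A]
    [L.Structure B] (ρ : A → B → Prop) : Prop where
  eq_iff : ∀ {a b a' b'}, ρ a b → ρ a' b' → (a = a' ↔ b = b')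
  const : ∀ c : L.Constants, ρ c c
  relMap_iff : ∀ {l : ℕ} (R : L.Relations l) (x : Fin l → A) (y : Fin l → B),
    (∀ i, ρ (x i) (y i)) → (Language.Structure.RelMap R x ↔ Language.Structure.RelMap R y)
  left_total : ∀ a ∈ adom L A, ∃ b, ρ a b
  right_total : ∀ b ∈ adom L B, ∃ a, ρ a b

/-- A winning position for the duplicator with `r` rounds left: a partial isomorphism matches the
chosen elements, and the sizes of the cells outside of it agree up to the threshold `2 ^ r - 1`. -/
structure Similar (r : ℕ) {n m : ℕ} (ρ : A → B → Prop) (x : Fin n → A) (y : Fin n → B)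
    (X : Fin m → Set A) (Y : Fin m → Set B) : Prop where
  iso : IsPartialIso L ρ
  elem : ∀ i, ρ (x i) (y i)
  mem_iff : ∀ {a b}, ρ a b → ∀ j, a ∈ X j ↔ b ∈ Y j
  agree : ∀ s : Fin m → Prop,
    AgreeUpTo (2 ^ r - 1) (cell ρ X s).ncard (cell (fun b a => ρ a b) Y s).ncard

lemma IsPartialIso.symm {ρ : A → B → Prop} (h : IsPartialIso L ρ) :
    IsPartialIso L (fun b a => ρ a b) where
  eq_iff h₁ h₂ := (h.eq_iff h₁ h₂).symm
  const := h.const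
  relMap_iff R x y hxy := (h.relMap_iff R y x hxy).symm
  left_total := h.right_total
  right_total := h.left_total

lemma IsPartialIso.insert {ρ : A → B → Prop} (h : IsPartialIso L ρ) {a : A} {b : B}
    (ha : ∀ b', ¬ ρ a b') (hb : ∀ a', ¬ ρ a' b) :
    IsPartialIso L (fun a' b' => ρ a' b' ∨ (a' = a ∧ b' = b)) where
  eq_iff := by
    rintro a₁ b₁ a₂ b₂ (h₁ | ⟨rfl, rfl⟩) (h₂ | ⟨rfl, rfl⟩)
    · exact h.eq_iff h₁ h₂
    · exact iff_of_false (fun e => ha _ (e ▸ h₁)) (fun e => hb _ (e ▸ h₁))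
    · exact iff_of_false (fun e => ha _ (e ▸ h₂)) (fun e => hb _ (e ▸ h₂))
    · simp
  const c := .inl (h.const c)
  relMap_iff := by
    intro l R x y hxy
    by_cases hall : ∀ i, ρ (x i) (y i)
    · exact h.relMap_iff R x y hall
    push Not at hall
    obtain ⟨i, hi⟩ := hall
    obtain ⟨hx, hy⟩ := (hxy i).resolve_left hi
    -- A tuple through `a` or `b` satisfies no relation: its entries would be active, hence already
    -- matched by `ρ`.
    refine iff_of_false (fun hR => ?_) (fun hR => ?_)
    · obtain ⟨b', hb'⟩ := h.left_total a (.inl ⟨l, R, x, hR, i, hx⟩)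
      exact ha _ hb'
    · obtain ⟨a', ha'⟩ := h.right_total b (.inl ⟨l, R, y, hR, i, hy⟩)
      exact hb _ ha'
  left_total a' h' := (h.left_total a' h').imp fun _ => .inl
  right_total b' h' := (h.right_total b' h').imp fun _ => .inl

variable {r n m : ℕ} {ρ : A → B → Prop} {x : Fin n → A} {y : Fin n → B}
  {X : Fin m → Set A} {Y : Fin m → Set B}

lemma Similar.symm (h : Similar (L := L) r ρ x y X Y) :
    Similar (L := L) r (fun b a => ρ a b) y x Y X where
  iso := h.iso.symm
  elem := h.elem
  mem_iff hab j := (h.mem_iff hab j).symm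
  agree s := (h.agree s).symm

lemma Similar.mono {r' : ℕ} (h : Similar (L := L) r ρ x y X Y) (hr : r' ≤ r) :
    Similar (L := L) r' ρ x y X Y where
  iso := h.iso
  elem := h.elem
  mem_iff := h.mem_iff
  agree s := by
    have h₁ := h.agree s
    have h₂ : 2 ^ r' ≤ 2 ^ r := Nat.pow_le_pow_right (by norm_num) hr
    unfold AgreeUpTo at *
    omega

lemma cell_insert (X : Fin m → Set A) (s : Fin m → Prop) (a : A) (b : B) :
    cell (fun a' b' => ρ a' b' ∨ (a' = a ∧ b' = b)) X s = cell ρ X s \ {a} := by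
  ext a'
  simp only [cell, Set.mem_ofPred_eq, Set.mem_sdiff, Set.mem_singleton_iff, not_or, not_and]
  constructor
  · rintro ⟨h₁, h₂⟩
    exact ⟨⟨fun b' => (h₁ b').1, h₂⟩, fun e => (h₁ b).2 e rfl⟩
  · rintro ⟨⟨h₁, h₂⟩, h₃⟩
    exact ⟨fun b' => ⟨h₁ b', fun e => (h₃ e).elim⟩, h₂⟩

/-! ### Moves of the game -/

lemma Similar.exists_elem [Finite A] [Finite B] (h : Similar (L := L) (r + 1) ρ x y X Y) (a : A) :
    ∃ (b : B) (ρ' : A → B → Prop), Similar (L := L) r ρ'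
      (Fin.snoc (α := fun _ => A) x a) (Fin.snoc (α := fun _ => B) y b) X Y := by
  by_cases hab : ∃ b, ρ a b
  · obtain ⟨b, hab⟩ := hab
    have h' := h.mono (Nat.le_succ r)
    refine ⟨b, ρ, h'.iso, ?_, h'.mem_iff, h'.agree⟩
    simpa [Fin.forall_fin_succ'] using ⟨h.elem, hab⟩
  push Not at hab
  have ha : a ∈ cell ρ X (fun j => a ∈ X j) := ⟨hab, fun _ => Iff.rfl⟩
  have hpos : 0 < 2 ^ r := by positivity
  -- The threshold `2 ^ (r + 1) - 1` is positive, so the cell opposite that of `a` is nonempty too.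
  obtain ⟨b, hb⟩ : (cell (fun b a => ρ a b) Y (fun j => a ∈ X j)).Nonempty := by
    have h₁ := h.agree (fun j => a ∈ X j)
    have h₂ : 0 < (cell ρ X (fun j => a ∈ X j)).ncard := (Set.ncard_pos).2 ⟨a, ha⟩
    refine (Set.ncard_pos (Set.toFinite _)).1 ?_
    unfold AgreeUpTo at h₁
    rw [pow_succ] at h₁
    omega
  refine ⟨b, _, h.iso.insert hab hb.1, ?_, ?_, fun s => ?_⟩
  · simpa [Fin.forall_fin_succ'] using fun i => Or.inl (h.elem i)
  · rintro a' b' (h' | ⟨rfl, rfl⟩) j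
    · exact h.mem_iff h' j
    · exact (hb.2 j).symm
  · have h₁ := h.agree s
    rw [cell_insert, show (fun (b' : B) (a' : A) => ρ a' b' ∨ (a' = a ∧ b' = b)) =
      (fun b' a' => ρ a' b' ∨ (b' = b ∧ a' = a)) by simp only [and_comm],
      cell_insert (ρ := fun b a => ρ a b)]
    have hs : a ∈ cell ρ X s ↔ b ∈ cell (fun b a => ρ a b) Y s := by
      refine and_congr (iff_of_true hab hb.1) (forall_congr' fun j => ?_)
      rw [hb.2 j]
    unfold AgreeUpTo at *
    rw [pow_succ] at h₁
    by_cases has : a ∈ cell ρ X s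
    · have h₂ := Set.ncard_sdiff_singleton_add_one has
      have h₃ := Set.ncard_sdiff_singleton_add_one (hs.1 has)
      omega
    · rw [Set.sdiff_singleton_eq_self has, Set.sdiff_singleton_eq_self (fun h => has (hs.2 h))]
      omega

lemma Similar.exists_set [Finite A] [Finite B] (h : Similar (L := L) (r + 1) ρ x y X Y)
    (S : Set A) :
    ∃ T : Set B, Similar (L := L) r ρ x y
      (Fin.snoc (α := fun _ => Set A) X S) (Fin.snoc (α := fun _ => Set B) Y T) := by
  have key : ∀ s : Fin m → Prop, AgreeUpTo (2 * (2 ^ r - 1)) (cell ρ X s).ncard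
      (cell (fun b a => ρ a b) Y s).ncard := fun s => by
    have h₁ := h.agree s
    unfold AgreeUpTo at *
    rw [pow_succ] at h₁
    omega
  choose T hT hT₁ hT₂ using fun s => (key s).exists_subset (S := S)
  -- The reply to `S` is forced on matched points; elsewhere it is glued from the pieces `T s`, one
  -- in each cell.
  let T' : Set B := {b | (∃ a ∈ S, ρ a b) ∨ b ∈ T (fun j => b ∈ Y j)}
  have hcell : ∀ s, ∀ b ∈ cell (fun b a => ρ a b) Y s, (b ∈ T' ↔ b ∈ T s) := by
    intro s b hb
    have hs : (fun j => b ∈ Y j) = s := funext fun j => propext (hb.2 j)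
    simp only [T', Set.mem_ofPred_eq, hs]
    exact or_iff_right fun ⟨a, _, ha⟩ => hb.1 a ha
  refine ⟨T', h.iso, h.elem, fun {a b} hab => ?_, fun s => ?_⟩
  · have hST : a ∈ S ↔ b ∈ T' := by
      refine ⟨fun ha => .inl ⟨a, ha, hab⟩, ?_⟩
      rintro (⟨a', ha', hab'⟩ | hb)
      · rwa [(h.iso.eq_iff hab hab').2 rfl]
      · exact ((hT _ hb).1 a hab).elim
    simpa [Fin.forall_fin_succ'] using ⟨h.mem_iff hab, hST⟩
  · rw [cell_snoc, cell_snoc]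
    by_cases hs : s (Fin.last m)
    · convert hT₁ (fun j => s j.castSucc) using 2
      · ext a; simp [hs]
      · ext b
        simp only [hs, iff_true, Set.mem_ofPred_eq]
        exact ⟨fun hb => (hcell _ b hb.1).1 hb.2, fun hb => ⟨hT _ hb, (hcell _ b (hT _ hb)).2 hb⟩⟩
    · convert hT₂ (fun j => s j.castSucc) using 2
      · ext a; simp [hs]
      · ext b
        simp only [hs, iff_false, Set.mem_ofPred_eq, Set.mem_sdiff]
        exact and_congr_right fun hb => not_congr (hcell _ b hb)

lemma Similar.term_realize [hL : IsSignature L] (h : Similar (L := L) r ρ x y X Y)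
    (t : L.Term (Fin n)) : ρ (t.realize x) (t.realize y) := by
  cases t with
  | var i => exact h.elem i
  | @func l f ts =>
    cases l with
    | zero =>
      simp only [Language.Term.realize]
      rw [Subsingleton.elim (fun i => (ts i).realize x) default,
        Subsingleton.elim (fun i => (ts i).realize y) default]
      exact h.iso.const f
    | succ l => exact ((hL.isEmpty_functions l).false f).elim

end Similar

/-! ### From the game to formulas -/

/-- Every `r` at least the depth is allowed, since the two sides of an implication may differ in
depth. -/
lemma MSOFormula.realize_iff_of_similar {L : FirstOrder.Language.{u, v}} [IsSignature L]
    {A B : Type*} [L.Structure A] [L.Structure B] [Finite A] [Finite B] {n m : ℕ}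
    (φ : MSOFormula L n m) : ∀ {r : ℕ} {ρ : A → B → Prop} {x : Fin n → A} {y : Fin n → B}
      {X : Fin m → Set A} {Y : Fin m → Set B}, φ.depth ≤ r → Similar (L := L) r ρ x y X Y →
      (φ.Realize x X ↔ φ.Realize y Y) := by
  induction φ with
  | falsum => intros; rfl
  | equal s t =>
    intro r ρ x y X Y _ h
    exact h.iso.eq_iff (h.term_realize s) (h.term_realize t)
  | rel R t =>
    intro r ρ x y X Y _ h
    exact h.iso.relMap_iff R _ _ fun i => h.term_realize (t i)
  | mem t j =>
    intro r ρ x y X Y _ h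
    exact h.mem_iff (h.term_realize t) j
  | imp φ ψ ih₁ ih₂ =>
    intro r ρ x y X Y hr h
    exact imp_congr (ih₁ ((le_max_left _ _).trans hr) h) (ih₂ ((le_max_right _ _).trans hr) h)
  | allElem φ ih =>
    intro r ρ x y X Y hr h
    obtain ⟨r, rfl⟩ := Nat.exists_eq_add_one_of_ne_zero (Nat.ne_of_gt (Nat.lt_of_succ_le hr).pos)
    replace hr := Nat.le_of_succ_le_succ hr
    constructor
    · intro hx b
      obtain ⟨a, ρ', h'⟩ := h.symm.exists_elem b
      exact (ih hr h'.symm).1 (hx a)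
    · intro hy a
      obtain ⟨b, ρ', h'⟩ := h.exists_elem a
      exact (ih hr h').2 (hy b)
  | exElem φ ih =>
    intro r ρ x y X Y hr h
    obtain ⟨r, rfl⟩ := Nat.exists_eq_add_one_of_ne_zero (Nat.ne_of_gt (Nat.lt_of_succ_le hr).pos)
    replace hr := Nat.le_of_succ_le_succ hr
    constructor
    · rintro ⟨a, ha⟩
      obtain ⟨b, ρ', h'⟩ := h.exists_elem a
      exact ⟨b, (ih hr h').1 ha⟩
    · rintro ⟨b, hb⟩
      obtain ⟨a, ρ', h'⟩ := h.symm.exists_elem b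
      exact ⟨a, (ih hr h'.symm).2 hb⟩
  | allSet φ ih =>
    intro r ρ x y X Y hr h
    obtain ⟨r, rfl⟩ := Nat.exists_eq_add_one_of_ne_zero (Nat.ne_of_gt (Nat.lt_of_succ_le hr).pos)
    replace hr := Nat.le_of_succ_le_succ hr
    constructor
    · intro hx T
      obtain ⟨S, h'⟩ := h.symm.exists_set T
      exact (ih hr h'.symm).1 (hx S)
    · intro hy S
      obtain ⟨T, h'⟩ := h.exists_set S
      exact (ih hr h').2 (hy T)
  | exSet φ ih =>
    intro r ρ x y X Y hr h
    obtain ⟨r, rfl⟩ := Nat.exists_eq_add_one_of_ne_zero (Nat.ne_of_gt (Nat.lt_of_succ_le hr).pos)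
    replace hr := Nat.le_of_succ_le_succ hr
    constructor
    · rintro ⟨S, hS⟩
      obtain ⟨T, h'⟩ := h.exists_set S
      exact ⟨T, (ih hr h').1 hS⟩
    · rintro ⟨T, hT⟩
      obtain ⟨S, h'⟩ := h.symm.exists_set T
      exact ⟨S, (ih hr h'.symm).2 hT⟩

/-! ### The initial position -/

lemma coe_constant_restrict {L : FirstOrder.Language.{u, v}} [IsSignature L] {A : Type*}
    [L.Structure A] {B : Set A} (c : L.Constants) :
    (((c : restrict L A B) : restrict L A B) : A) = (c : A) :=
  congrArg (Language.Structure.funMap c) (Subsingleton.elim _ _)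

/-- Without set variables there is only one cell on each side, and both contain `B` minus the at
most `k` entries of `a`. -/
lemma similar_restrict {L : FirstOrder.Language.{u, v}} [IsSignature L] {A : Type*}
    [L.Structure A] [Finite A] {B : Set A} (hB : B ⊆ (adom L A)ᶜ) {r k : ℕ}
    (hcard : 2 ^ r - 1 + k ≤ B.ncard) (a : Fin k → restrict L A B) :
    Similar (L := L) r
      (fun (u : A) (v : restrict L A B) => u = v ∧ (u ∈ adom L A ∨ ∃ i, u = a i))
      (fun i => (a i : A)) a (Fin.elim0 : Fin 0 → Set A) Fin.elim0 where
  iso :=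
    { eq_iff := by
        rintro u v u' v' ⟨rfl, -⟩ ⟨rfl, -⟩
        exact Subtype.ext_iff.symm
      const := fun c => ⟨(coe_constant_restrict c).symm, .inl (.inr ⟨c, rfl⟩)⟩
      relMap_iff := by
        intro l R x y hxy
        rw [show x = fun i => (y i : A) from funext fun i => (hxy i).1]
        rfl
      left_total := fun u hu => ⟨⟨u, .inl hu⟩, rfl, .inl hu⟩
      right_total := by
        intro v hv
        refine ⟨v, rfl, .inl ?_⟩
        rcases hv with ⟨l, R, x, hR, i, rfl⟩ | ⟨c, rfl⟩
        · exact .inl ⟨l, R, fun i => (x i : A), hR, i, rfl⟩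
        · exact .inr ⟨c, (coe_constant_restrict c).symm⟩ }
  elem i := ⟨rfl, .inr ⟨i, rfl⟩⟩
  mem_iff _ j := j.elim0
  agree s := by
    have hk : (Set.range fun i => (a i : A)).ncard ≤ k := by
      rw [← Set.image_univ]
      exact (Set.ncard_image_le Set.finite_univ).trans (by simp [Set.ncard_univ])
    have hdiff := Set.le_ncard_sdiff (Set.range fun i => (a i : A)) B (Set.toFinite _)
    have hle : 2 ^ r - 1 ≤ (B \ Set.range fun i => (a i : A)).ncard := by omega
    refine .inr ⟨hle.trans (Set.ncard_le_ncard ?_ (Set.toFinite _)), hle.trans ?_⟩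
    · rintro u ⟨hu, hua⟩
      refine ⟨?_, fun j => j.elim0⟩
      rintro v ⟨-, h | ⟨i, hi⟩⟩
      · exact hB hu h
      · exact hua ⟨i, hi.symm⟩
    · rw [← Set.ncard_image_of_injective _ (Subtype.val_injective (p := (· ∈ restrict L A B)))]
      refine Set.ncard_le_ncard ?_ (Set.toFinite _)
      rintro u ⟨hu, hua⟩
      refine ⟨⟨u, .inr hu⟩, ⟨?_, fun j => j.elim0⟩, rfl⟩
      rintro v ⟨rfl, h | ⟨i, hi⟩⟩
      · exact hB hu h
      · exact hua ⟨i, hi.symm⟩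

theorem Query.DefinedBy.almostDomainIndependentWith {L : FirstOrder.Language.{u, v}}
    [IsSignature L] {k : ℕ} {q : Query.{u, v, w} L k} {φ : MSOFormula L k 0}
    (hq : q.DefinedBy φ) : q.AlmostDomainIndependentWith (2 ^ φ.depth * φ.depth + k) := by
  intro A _ _ B hB hcard
  -- The game needs only `2 ^ d - 1 + k` points; the stated constant is at least that, also for `d =
  -- 0`.
  have hthreshold : 2 ^ φ.depth - 1 ≤ 2 ^ φ.depth * φ.depth := by
    rcases Nat.eq_zero_or_pos φ.depth with h | h
    · simp [h]
    · exact (Nat.sub_le _ _).trans (Nat.le_mul_of_pos_right _ h)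
  rw [hq A, hq (restrict L A B)]
  ext a
  exact φ.realize_iff_of_similar le_rfl (similar_restrict hB (by omega) a)

end MSOQuery

theorem mainTheorem9 {L : FirstOrder.Language.{u, v}} [MSOQuery.IsSignature L] {k : ℕ}
    (q : MSOQuery.Query.{u, v, w} L k) :
    (q.IsMSODefinable → q.AlmostDomainIndependent) ∧
    ∀ φ : MSOQuery.MSOFormula L k 0, q.DefinedBy φ →
      q.AlmostDomainIndependentWith (2 ^ φ.depth * φ.depth + k) :=
  ⟨fun ⟨_, hφ⟩ => ⟨_, hφ.almostDomainIndependentWith⟩,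
    fun _ hφ => hφ.almostDomainIndependentWith⟩
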